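/- Let $F$ be a number field, with ring of integers $\mathcal O_F$, completions $F_v$ with rings of integers $\mathcal O_v$ and maximal ideals $\mathfrak p_v$ at the finite places $v$, and ring of finite adeles $\mathbb A_{F,f}$. Let $n\ge 1$. For $m\ge 0$ let ${\rm O}(m)$ be the group of invertible matrices $g$ with ${}^{\mathsf T}g\,J_m\,g=J_m$, where $J_m$ is the $m\times m$ matrix with ones on the antidiagonal and zeros elsewhere. Put $G_f={\rm O}(2n+2)(\mathbb A_{F,f})$, and let $P_f\subset G_f$ be the $\mathbb A_{F,f}$-points of the parabolic subgroup $P$ of block upper triangular matrices with diagonal blocks $x,\,g,\,x^{-1}$ of sizes $1,2n,1$; its Levi quotient is ${\rm GL}_1\times{\rm O}(2n)$, through $(x,g)$. Let $\kappa_{2n}\in{\rm O}(2n)$ be the identity matrix with its middle $2\times2$ block replaced by $J_2$. Let $E$ be a field of characteristic $0$. For a representation $\tau$ of $\mathbb A_{F,f}^\times\times{\rm O}(2n)(\mathbb A_{F,f})$ on an $E$-vector space $V$, let ${}^{\rm a}{\rm Ind}_{P_f}^{G_f}(\tau)$ be the un-normalised induced representation: the space of functions $f:G_f\to V$ that are right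 invariant under some open subgroup of $G_f$ and satisfy $f(ph)=\tau(x,g)f(h)$ for all $h\in G_f$ and all $p\in P_f$ with image $(x,g)$ in the Levi quotient, on which $G_f$ acts by right translation. Let $\chi_f:\mathbb A_{F,f}^\times\to E^\times$ be a character with open kernel (for example the finite part of an algebraic Hecke character of $F$ with values in $E$), and let $\sigma_f$ be an admissible representation of ${\rm O}(2n)(\mathbb A_{F,f})$ over $E$, i.e. every vector is fixed by an open subgroup, and for every open subgroup the space of its fixed vectors is finite-dimensional. Put $\chi_f^{-1}[2n]=\chi_f^{-1}\otimes|\ |_f^{2n}$, where $|x|_f=\prod_{v}|x_v|_v$ is the product over the finite places of the normalised absolute values, and let ${}^{\kappa_{2n}}\sigma_f$ be the representation $g\mapsto\sigma_f(\kappa_{2n}^{-1}\,g\,\kappa_{2n})$ on the space of $\sigma_f$. Let $K_f=\prod_{v}K_v\subset G_f$ ($v$ over the finite places), where $K_v={\rm O}(2n+2)(\mathcal O_v)$ for all but finitely many $v$, and for each of the remaining places $K_v$ is a principal congruence subgroup of ${\rm O}(2n+2)(\mathcal O_v)$, i.e. the kernel of reduction modulo $\mathfrak p_v^{k_v}$ for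 some $k_v\ge 1$. (In particular $K_f$ may be any neat group of this form.) Then the spaces of $K_f$-invariants below are finite-dimensional over $E$, and $$ \dim_E\left({}^{\rm a}{\rm Ind}^{G_f}_{P_f}(\chi_f\times\sigma_f)\right)^{K_f} \;=\; \dim_E\left({}^{\rm a}{\rm Ind}^{G_f}_{P_f}\left(\chi_f^{-1}[2n]\times{}^{\kappa_{2n}}\sigma_f\right)\right)^{K_f}. $$ -/

import Mathlib

open IsDedekindDomain
open scoped NumberField

namespace EqualDim

noncomputable section

/-! ### Split orthogonal groups -/

/-- The `m × m` matrix `J_m` with ones on the antidiagonal. -/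
def antiJ (m : ℕ) (R : Type*) [CommRing R] : Matrix (Fin m) (Fin m) R :=
  Matrix.of fun i j => if j = Fin.rev i then 1 else 0

/-- `O(m)(R)`: the invertible matrices `g` over `R` with `ᵗg J g = J`. -/
def orthGroup (m : ℕ) (R : Type*) [CommRing R] : Subgroup (GL (Fin m) R) where
  carrier := {g | (g : Matrix (Fin m) (Fin m) R).transpose * antiJ m R * g = antiJ m R}
  one_mem' := by simp
  mul_mem' := by
    intro a b ha hb
    change (a.val * b.val).transpose * antiJ m R * (a.val * b.val) = antiJ m R
    have ha' : a.val.transpose * antiJ m R * a.val = antiJ m R := ha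
    have hb' : b.val.transpose * antiJ m R * b.val = antiJ m R := hb
    calc (a.val * b.val).transpose * antiJ m R * (a.val * b.val)
        = b.val.transpose * (a.val.transpose * antiJ m R * a.val) * b.val := by
          simp only [Matrix.transpose_mul, Matrix.mul_assoc]
      _ = antiJ m R := by rw [ha', hb']
  inv_mem' := by
    intro a ha
    change (a⁻¹).val.transpose * antiJ m R * (a⁻¹).val = antiJ m R
    have ha' : a.val.transpose * antiJ m R * a.val = antiJ m R := ha
    have h1 : a.val * (a⁻¹).val = 1 := a.mul_inv
    have h2 : (a⁻¹).val.transpose * a.val.transpose = 1 := by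
      rw [← Matrix.transpose_mul, h1, Matrix.transpose_one]
    calc (a⁻¹).val.transpose * antiJ m R * (a⁻¹).val
        = (a⁻¹).val.transpose * (a.val.transpose * antiJ m R * a.val) * (a⁻¹).val := by rw [ha']
      _ = ((a⁻¹).val.transpose * a.val.transpose) * antiJ m R * (a.val * (a⁻¹).val) := by
          simp only [Matrix.mul_assoc]
      _ = antiJ m R := by rw [h2, h1, Matrix.one_mul, Matrix.mul_one]

theorem mem_orthGroup {m : ℕ} {R : Type*} [CommRing R] {g : GL (Fin m) R} :
    g ∈ orthGroup m R ↔
      (g : Matrix (Fin m) (Fin m) R).transpose * antiJ m R * g = antiJ m R := Iff.rfl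

/-- The `(i, j)` entry of `g ∈ O(m)(R)`. -/
def entry {m : ℕ} {R : Type*} [CommRing R] (g : orthGroup m R) (i j : Fin m) : R :=
  (g : GL (Fin m) R).val i j

theorem antiJ_map {m : ℕ} {R S : Type*} [CommRing R] [CommRing S] (f : R →+* S) :
    (antiJ m R).map f = antiJ m S := by
  ext i j
  simp only [antiJ, Matrix.map_apply, Matrix.of_apply]
  split_ifs <;> simp

theorem antiJ_mul_self (m : ℕ) (R : Type*) [CommRing R] : antiJ m R * antiJ m R = 1 := by
  ext i j
  have h : ∀ x : Fin m, (j = Fin.rev x) ↔ (x = Fin.rev j) := fun x => by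
    constructor <;> rintro rfl <;> simp
  have h' : (j = i) ↔ (i = j) := eq_comm
  simp [antiJ, Matrix.mul_apply, Matrix.one_apply, h, h']

/-- The homomorphism `O(m)(R) → O(m)(S)` induced by a ring homomorphism `R → S`. -/
def orthMap (m : ℕ) {R S : Type*} [CommRing R] [CommRing S] (f : R →+* S) :
    orthGroup m R →* orthGroup m S :=
  ((Matrix.GeneralLinearGroup.map f).comp (orthGroup m R).subtype).codRestrict _ (by
    rintro ⟨g, hg⟩
    rw [mem_orthGroup] at hg ⊢
    have h := congrArg (fun M : Matrix (Fin m) (Fin m) R => M.map f) hg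
    simp only [Matrix.map_mul, antiJ_map] at h
    exact h)

theorem entry_orthMap {m : ℕ} {R S : Type*} [CommRing R] [CommRing S] (f : R →+* S)
    (g : orthGroup m R) (i j : Fin m) : entry (orthMap m f g) i j = f (entry g i j) := rfl

theorem entry_one {m : ℕ} {R : Type*} [CommRing R] (i j : Fin m) :
    entry (1 : orthGroup m R) i j = if i = j then 1 else 0 := rfl

theorem entry_mul {m : ℕ} {R : Type*} [CommRing R] (g h : orthGroup m R) (i j : Fin m) :
    entry (g * h) i j = ∑ k, entry g i k * entry h k j := rfl

theorem entry_inv {m : ℕ} {R : Type*} [CommRing R] (g : orthGroup m R) (i j : Fin m) :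
    entry g⁻¹ i j = entry g (Fin.rev j) (Fin.rev i) := by
  obtain ⟨g, hg⟩ := g
  rw [mem_orthGroup] at hg
  have h1 : g.val * (g⁻¹).val = 1 := g.mul_inv
  have h2 : (g⁻¹).val = antiJ m R * g.val.transpose * antiJ m R := by
    calc (g⁻¹).val = antiJ m R * antiJ m R * (g⁻¹).val := by
          rw [antiJ_mul_self, Matrix.one_mul]
      _ = antiJ m R * (g.val.transpose * antiJ m R * g.val) * (g⁻¹).val := by rw [hg]
      _ = antiJ m R * g.val.transpose * antiJ m R * (g.val * (g⁻¹).val) := by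
          simp only [Matrix.mul_assoc]
      _ = _ := by rw [h1, Matrix.mul_one]
  change (g⁻¹).val i j = g.val (Fin.rev j) (Fin.rev i)
  rw [h2]
  have hr : ∀ x : Fin m, (j = Fin.rev x) ↔ (x = Fin.rev j) := fun x => by
    constructor <;> rintro rfl <;> simp
  simp [antiJ, Matrix.mul_apply, hr]

/-- The matrix `κ_{2n}`, which is the identity matrix with `J_2` in the middle `2 × 2` block
(positions `n - 1` and `n`, counted from `0`). -/
def kappaMatrix (n : ℕ) (R : Type*) [CommRing R] : Matrix (Fin (2 * n)) (Fin (2 * n)) R :=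
  Matrix.of fun i j => if (j : ℕ) = Equiv.swap (n - 1) n (i : ℕ) then 1 else 0

/-- The exchange of the two middle indices of `Fin (2 * n)`. -/
def midSwap (n : ℕ) (i : Fin (2 * n)) : Fin (2 * n) :=
  ⟨Equiv.swap (n - 1) n (i : ℕ), by
    have := i.2
    rw [Equiv.swap_apply_def]; split_ifs <;> omega⟩

theorem kappaMatrix_apply (n : ℕ) (R : Type*) [CommRing R] (i j : Fin (2 * n)) :
    kappaMatrix n R i j = if j = midSwap n i then 1 else 0 := by
  simp [kappaMatrix, midSwap, Fin.ext_iff]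

theorem midSwap_midSwap (n : ℕ) (i : Fin (2 * n)) : midSwap n (midSwap n i) = i := by
  simp [midSwap]

theorem midSwap_rev (n : ℕ) (i : Fin (2 * n)) :
    midSwap n (Fin.rev i) = Fin.rev (midSwap n i) := by
  have := i.2
  ext
  simp only [midSwap, Fin.val_rev, Equiv.swap_apply_def]
  split_ifs <;> omega

theorem kappaMatrix_mul_self (n : ℕ) (R : Type*) [CommRing R] :
    kappaMatrix n R * kappaMatrix n R = 1 := by
  ext i j
  rw [Matrix.mul_apply, Finset.sum_eq_single (midSwap n i)]
  · have h : (j = i) ↔ (i = j) := eq_comm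
    simp [kappaMatrix_apply, midSwap_midSwap, Matrix.one_apply, h]
  · intro x _ hx
    simp [kappaMatrix_apply, hx]
  · simp

/-- `κ_{2n}` as an element of `O(2n)(R)`. -/
def kappa (n : ℕ) (R : Type*) [CommRing R] : orthGroup (2 * n) R :=
  ⟨⟨kappaMatrix n R, kappaMatrix n R, kappaMatrix_mul_self n R, kappaMatrix_mul_self n R⟩, by
    rw [mem_orthGroup]
    ext i j
    have h : ∀ x : Fin (2 * n), (i = midSwap n x) ↔ (x = midSwap n i) := fun x => by
      constructor <;> rintro rfl <;> simp [midSwap_midSwap]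
    change ((kappaMatrix n R).transpose * antiJ (2 * n) R * kappaMatrix n R) i j = _
    rw [Matrix.mul_apply, Finset.sum_eq_single (Fin.rev (midSwap n i))]
    · simp [Matrix.mul_apply, kappaMatrix_apply, antiJ, h, midSwap_rev, midSwap_midSwap]
    · intro x _ hx
      have h0 : ((kappaMatrix n R).transpose * antiJ (2 * n) R) i x = 0 := by
        rw [Matrix.mul_apply]
        refine Finset.sum_eq_zero fun y _ => ?_
        by_cases hy : y = midSwap n i
        · subst hy
          simp [antiJ, hx]
        · have hy' : ¬ i = midSwap n y := fun e => hy ((h y).1 e)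
          simp [kappaMatrix_apply, hy']
      rw [h0, zero_mul]
    · simp⟩

/-! ### The parabolic subgroup and its Levi quotient -/

/-- `p ∈ O(2n+2)(R)` lies in the standard parabolic subgroup `P` with Levi quotient
`M = GL(1) × O(2n)` (the stabilizer of the line spanned by the first basis vector), and
`(x, g)` is its image in `M(R)`; that is, `p` is block upper triangular with diagonal blocks
`x, g, x⁻¹`. Equivalently, `p = diag(x, g, x⁻¹) u` with `u` in the unipotent radical of `P`. -/
structure IsParabolicOver {n : ℕ} {R : Type*} [CommRing R] (p : orthGroup (2 * n + 2) R)
    (x : Rˣ) (g : orthGroup (2 * n) R) : Prop where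
  first_column : ∀ i, i ≠ 0 → entry p i 0 = 0
  last_row : ∀ j, j ≠ Fin.last (2 * n + 1) → entry p (Fin.last (2 * n + 1)) j = 0
  first_block : entry p 0 0 = (x : R)
  last_block : entry p (Fin.last (2 * n + 1)) (Fin.last (2 * n + 1)) = ((x⁻¹ : Rˣ) : R)
  middle_block : ∀ i j : Fin (2 * n), entry p i.castSucc.succ j.castSucc.succ = entry g i j

/-! ### Smooth representations and parabolic induction -/

section Representations

variable {E : Type*} [Field E]

/-- The space `V^K` of vectors fixed by a subgroup `K`. -/
abbrev fixedBy {G V : Type*} [Group G] [AddCommGroup V] [Module E V]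
    (ρ : Representation E G V) (K : Subgroup G) : Submodule E V :=
  Representation.invariants (ρ.comp K.subtype)

/-- A representation is smooth if every vector is fixed by an open subgroup. -/
def IsSmoothRep {G V : Type*} [Group G] [TopologicalSpace G] [AddCommGroup V] [Module E V]
    (ρ : Representation E G V) : Prop :=
  ∀ w : V, ∃ U : Subgroup G, IsOpen (U : Set G) ∧ w ∈ fixedBy ρ U

/-- A representation is admissible if it is smooth and the vectors fixed by any given open
subgroup form a finite-dimensional space. -/
def IsAdmissibleRep {G V : Type*} [Group G] [TopologicalSpace G] [AddCommGroup V] [Module E V]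
    (ρ : Representation E G V) : Prop :=
  IsSmoothRep ρ ∧ ∀ U : Subgroup G, IsOpen (U : Set G) → Module.Finite E (fixedBy ρ U)

/-- The representation `ʰρ : g ↦ ρ (h⁻¹ g h)`. -/
def conjRep {G V : Type*} [Group G] [AddCommGroup V] [Module E V]
    (h : G) (ρ : Representation E G V) : Representation E G V :=
  ρ.comp (MulAut.conj h⁻¹).toMonoidHom

/-- The representation `χ × σ` of `A × H` on the space of `σ`, for a character `χ` of `A`. -/
def charTimes {A H V : Type*} [CommGroup A] [Group H] [AddCommGroup V] [Module E V]
    (χ : A →* Eˣ) (σ : Representation E H V) : Representation E (A × H) V where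
  toFun a := ((χ a.1 : Eˣ) : E) • σ a.2
  map_one' := by simp
  map_mul' a b := by
    ext w
    simp [smul_smul, mul_comm]

/-- The space of the algebraically (un-normalised) induced representation `ᵃInd_P^G τ`:
the functions `f : G(R) → V` with `f (p h) = τ (p mod U_P) (f h)` for all `p ∈ P(R)`, `h ∈ G(R)`,
that are right invariant under some open subgroup of `G(R)`. Here `G = O(2n+2)` and `τ` is a
representation of `M(R) = GL(1)(R) × O(2n)(R)`. -/
def indSpace {n : ℕ} {R : Type*} [CommRing R] [TopologicalSpace R] {V : Type*}
    [AddCommGroup V] [Module E V] (τ : Representation E (Rˣ × orthGroup (2 * n) R) V) :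
    Submodule E (orthGroup (2 * n + 2) R → V) where
  carrier := {f | (∀ p x g, IsParabolicOver p x g → ∀ h, f (p * h) = τ (x, g) (f h)) ∧
    ∃ U : Subgroup (orthGroup (2 * n + 2) R), IsOpen (U : Set (orthGroup (2 * n + 2) R)) ∧
      ∀ u ∈ U, ∀ h, f (h * u) = f h}
  zero_mem' := ⟨fun p x g _ h => by simp, ⊤, isOpen_univ, fun u _ h => rfl⟩
  add_mem' := by
    rintro f₁ f₂ ⟨h1, U₁, hU₁, hf₁⟩ ⟨h2, U₂, hU₂, hf₂⟩
    refine ⟨fun p x g hp h => ?_, U₁ ⊓ U₂, hU₁.inter hU₂, fun u hu h => ?_⟩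
    · simp [h1 p x g hp h, h2 p x g hp h]
    · simp [hf₁ u hu.1 h, hf₂ u hu.2 h]
  smul_mem' := by
    rintro c f ⟨h1, U, hU, hf⟩
    refine ⟨fun p x g hp h => ?_, U, hU, fun u hu h => ?_⟩
    · simp [h1 p x g hp h]
    · simp [hf u hu h]

/-- `ᵃInd_P^G τ` as a representation of `G(R)`, which acts by right translation. -/
def algInd {n : ℕ} {R : Type*} [CommRing R] [TopologicalSpace R] [IsTopologicalRing R]
    {V : Type*} [AddCommGroup V] [Module E V]
    (τ : Representation E (Rˣ × orthGroup (2 * n) R) V) :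
    Representation E (orthGroup (2 * n + 2) R) (indSpace τ) where
  toFun a :=
    { toFun := fun f => ⟨fun h => f.1 (h * a), by
        obtain ⟨f, h1, U, hU, hf⟩ := f
        refine ⟨fun p x g hp h => ?_, U.comap (MulAut.conj a⁻¹).toMonoidHom, ?_, fun u hu h => ?_⟩
        · simpa [mul_assoc] using h1 p x g hp (h * a)
        · refine hU.preimage ?_
          change Continuous fun u => a⁻¹ * u * (a⁻¹)⁻¹
          fun_prop
        · have h2 := hf (a⁻¹ * u * (a⁻¹)⁻¹) hu (h * a)
          simpa [mul_assoc] using h2⟩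
      map_add' := fun _ _ => rfl
      map_smul' := fun _ _ => rfl }
  map_one' := by
    ext f h
    simp
  map_mul' a b := by
    ext f h
    simp [mul_assoc]

end Representations

/-! ### Finite adeles: absolute value and level subgroups -/

section Adeles

variable (F : Type*) [Field F] [NumberField F]

/-- The ring `𝔸_{F,f}` of finite adeles of the number field `F`. -/
abbrev FinAdele : Type _ := FiniteAdeleRing (𝓞 F) F

variable {F}

/-- The projection `𝔸_{F,f} → F_v`. -/
def adeleProj (v : HeightOneSpectrum (𝓞 F)) : FinAdele F →+* v.adicCompletion F where
  toFun a := a v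
  map_one' := rfl
  map_mul' _ _ := rfl
  map_zero' := rfl
  map_add' _ _ := rfl

/-- The normalised absolute value `|x|_v = q_v ^ (-ord_v x)` of a finite idele `x`
at the place `v`. -/
def localAbs (v : HeightOneSpectrum (𝓞 F)) (x : (FinAdele F)ˣ) : ℚ :=
  (Ideal.absNorm v.asIdeal : ℚ) ^ WithZero.log (Valued.v ((x : FinAdele F) v))

theorem absNorm_ne_zero (v : HeightOneSpectrum (𝓞 F)) : (Ideal.absNorm v.asIdeal : ℚ) ≠ 0 := by
  have h : Ideal.absNorm v.asIdeal ≠ 0 := by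
    rw [Ne, Ideal.absNorm_eq_zero_iff]
    exact v.ne_bot
  exact_mod_cast h

theorem unit_apply_ne_zero (v : HeightOneSpectrum (𝓞 F)) (x : (FinAdele F)ˣ) :
    (x : FinAdele F) v ≠ 0 :=
  (FiniteAdeleRing.isUnit_iff.1 x.isUnit).1 v

theorem localAbs_mul (v : HeightOneSpectrum (𝓞 F)) (x y : (FinAdele F)ˣ) :
    localAbs v (x * y) = localAbs v x * localAbs v y := by
  have h : ((x * y : (FinAdele F)ˣ) : FinAdele F) v = (x : FinAdele F) v * (y : FinAdele F) v :=
    rfl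
  rw [localAbs, h, map_mul, WithZero.log_mul, zpow_add₀ (absNorm_ne_zero v)]
  · rfl
  · simpa using unit_apply_ne_zero v x
  · simpa using unit_apply_ne_zero v y

theorem localAbs_one (v : HeightOneSpectrum (𝓞 F)) : localAbs v (1 : (FinAdele F)ˣ) = 1 := by
  have h : ((1 : (FinAdele F)ˣ) : FinAdele F) v = 1 := rfl
  rw [localAbs, h, map_one, WithZero.log_one, zpow_zero]

theorem localAbs_finite_support (x : (FinAdele F)ˣ) :
    (Function.mulSupport fun v => localAbs v x).Finite := by
  have h := (FiniteAdeleRing.isUnit_iff.1 x.isUnit).2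
  rw [Filter.eventually_cofinite] at h
  refine h.subset fun v hv hv' => hv ?_
  simp only [localAbs, hv', WithZero.log_one, zpow_zero]

/-- The absolute value `|x|_f = ∏_v |x|_v` of finite ideles (`v` runs over the finite places;
almost all factors are `1`), as a homomorphism to `ℚ`. -/
def ideleAbs : (FinAdele F)ˣ →* ℚ where
  toFun x := ∏ᶠ v, localAbs v x
  map_one' := by simp [localAbs_one]
  map_mul' x y := by
    rw [← finprod_mul_distrib (localAbs_finite_support x) (localAbs_finite_support y)]
    exact finprod_congr fun v => localAbs_mul v x y

/-- The Tate twist `χ[k] = χ ⊗ |·|_f ^ k` of a character of the finite ideles. -/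
def tateTwist {E : Type*} [Field E] [CharZero E] (χ : (FinAdele F)ˣ →* Eˣ) (k : ℤ) :
    (FinAdele F)ˣ →* Eˣ :=
  χ * ((Units.map (algebraMap ℚ E : ℚ →* E)).comp ideleAbs.toHomUnits) ^ k

/-- For `k = 0` this is `O(m)(𝒪_v)`, and for `k ≥ 1` the principal congruence subgroup of
level `𝔭_v ^ k` of `O(m)(𝒪_v)`: the `g ∈ O(m)(F_v)` all of whose entries are congruent
modulo `𝔭_v ^ k` to those of the identity matrix. -/
def localCongruence (m : ℕ) (v : HeightOneSpectrum (𝓞 F)) (k : ℕ) :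
    Subgroup (orthGroup m (v.adicCompletion F)) where
  carrier := {g | ∀ i j, Valued.v (entry g i j - if i = j then 1 else 0) ≤
    WithZero.exp (-(k : ℤ))}
  one_mem' := by
    intro i j
    simp [entry_one]
  mul_mem' := by
    intro a b ha hb i j
    have hk : WithZero.exp (-(k : ℤ)) ≤ 1 := by
      rw [← WithZero.exp_zero, WithZero.exp_le_exp]
      omega
    have key : entry (a * b) i j - (if i = j then 1 else 0) =
        (∑ l, (entry a i l - if i = l then 1 else 0) * (entry b l j))
          + (entry b i j - if i = j then 1 else 0) := by
      simp [entry_mul, sub_mul, Finset.sum_sub_distrib]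
    rw [key]
    refine (Valuation.map_add _ _ _).trans (max_le ?_ (hb i j))
    refine Valuation.map_sum_le _ fun l _ => ?_
    have hbl : Valued.v (entry b l j) ≤ 1 := by
      have h : entry b l j = (entry b l j - if l = j then 1 else 0) + if l = j then 1 else 0 := by
        ring
      rw [h]
      refine (Valuation.map_add _ _ _).trans (max_le ((hb l j).trans hk) ?_)
      split_ifs <;> simp
    rw [map_mul]
    exact (mul_le_mul' (ha i l) hbl).trans (by rw [mul_one])
  inv_mem' := by
    intro a ha i j
    have h := ha (Fin.rev j) (Fin.rev i)
    rw [entry_inv]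
    have h' : (Fin.rev j = Fin.rev i) = (i = j) := by
      rw [Fin.rev_inj]; exact propext eq_comm
    simpa only [h'] using h

/-- The level subgroup `K_f = ∏_v K_v ⊆ O(m)(𝔸_{F,f})`, where `K_v` is `O(m)(𝒪_v)` if `k v = 0`
(all but finitely many `v`) and the principal congruence subgroup of level `𝔭_v ^ (k v)` of
`O(m)(𝒪_v)` otherwise. -/
def levelSubgroup (m : ℕ) (k : HeightOneSpectrum (𝓞 F) →₀ ℕ) :
    Subgroup (orthGroup m (FinAdele F)) :=
  ⨅ v, (localCongruence m v (k v)).comap (orthMap m (adeleProj v))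

end Adeles

end

end EqualDim

namespace EqualDim

/-! ### Constructing elements of orthogonal groups -/

section Orthogonal

variable {R : Type*} [CommRing R] {m n : ℕ}

/-! Both dimensions equal (number of double cosets in P_f\G_f/K_f) · (dimension of one and the same
subspace of V). Write K₀ = ∏ O(2n+2)(𝒪_v). By the Iwasawa decomposition (`iwasawa`) G_f = P_f K₀, so
double cosets have representatives r in K₀. Since K_f is normal in K₀, the condition on the value
f(r) of a K_f-invariant f is the same for every r: f(r) must be fixed by the image of P_f ∩ rK_f r⁻¹
= P_f ∩ K_f in the Levi quotient. Hence the invariants are the functions from the double cosets to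
`leviInvariants` (`nonempty_equivariantFunctions_equiv`), and there are finitely many double cosets
because K_f has finite index in K₀. It remains to compare the two subspaces of V
(`leviInvariants_twist`). The image of P_f ∩ K_f is a product of a group of idele units and the
level subgroup of O(2n). On idele units |x|_f = 1, so the twist is trivial; a vector is fixed by
χ(x)⁻¹ iff it is fixed by χ(x); and κ is integral, so it normalises the level subgroup of O(2n). The
two subspaces are equal, not merely of equal dimension. -/

theorem orthGroup_ext {g h : orthGroup m R} (H : ∀ i j, entry g i j = entry h i j) : g = h :=
  Subtype.ext (Units.ext (Matrix.ext H))

theorem transpose_mul_antiJ_mul_apply (A : Matrix (Fin m) (Fin m) R) (i j : Fin m) :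
    (A.transpose * antiJ m R * A) i j = ∑ l, A l i * A (Fin.rev l) j := by
  simp [Matrix.mul_apply, antiJ, Finset.sum_mul, ite_mul, mul_ite]
  rw [Finset.sum_comm]
  refine Finset.sum_congr rfl fun l _ => ?_
  simp

/-- The defining relation of O(m) as a pairing of two columns; with i = j = 0 it says that the first
column is isotropic (for m ≥ 2). -/
theorem sum_entry_mul_entry_rev (g : orthGroup m R) (i j : Fin m) :
    ∑ l, entry g l i * entry g (Fin.rev l) j = if j = Fin.rev i then 1 else 0 := by
  have h := congrFun (congrFun (mem_orthGroup.1 g.2) i) j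
  rwa [transpose_mul_antiJ_mul_apply] at h

/-- The element of `O(m)(R)` given by a matrix preserving the form `J_m`. -/
def orthOfMatrix (A : Matrix (Fin m) (Fin m) R)
    (h : ∀ i j, ∑ l, A l i * A (Fin.rev l) j = if j = Fin.rev i then 1 else 0) :
    orthGroup m R :=
  have hA : A.transpose * antiJ m R * A = antiJ m R := by
    ext i j
    rw [transpose_mul_antiJ_mul_apply, h]
    rfl
  have hl : (antiJ m R * A.transpose * antiJ m R) * A = 1 := by
    rw [Matrix.mul_assoc, Matrix.mul_assoc, ← Matrix.mul_assoc A.transpose, hA, antiJ_mul_self]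
  ⟨⟨A, antiJ m R * A.transpose * antiJ m R, mul_eq_one_comm.1 hl, hl⟩, hA⟩

@[simp]
theorem entry_orthOfMatrix (A : Matrix (Fin m) (Fin m) R)
    (h : ∀ i j, ∑ l, A l i * A (Fin.rev l) j = if j = Fin.rev i then 1 else 0) (i j : Fin m) :
    entry (orthOfMatrix A h) i j = A i j := rfl

/-- The permutation matrix of a permutation commuting with the reversal of the indices. -/
def permOrth (R : Type*) [CommRing R] (π : Equiv.Perm (Fin m))
    (hπ : ∀ i, π (Fin.rev i) = Fin.rev (π i)) : orthGroup m R :=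
  orthOfMatrix (Matrix.of fun i j => if i = π j then 1 else 0) fun i j => by
    simp only [Matrix.of_apply, ite_mul, one_mul, zero_mul, Finset.sum_ite_eq', Finset.mem_univ,
      if_true, ← hπ, π.injective.eq_iff]
    simp only [eq_comm]

theorem entry_permOrth (π : Equiv.Perm (Fin m)) (hπ : ∀ i, π (Fin.rev i) = Fin.rev (π i))
    (i j : Fin m) : entry (permOrth R π hπ) i j = if i = π j then 1 else 0 := rfl

/-! ### Matrices with a distinguished first and last index -/

theorem sum_first_mid_last {A : Type*} [AddCommMonoid A] (f : Fin (n + 2) → A) :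
    ∑ i, f i = f 0 + ∑ i : Fin n, f i.castSucc.succ + f (Fin.last (n + 1)) := by
  rw [Fin.sum_univ_succ, Fin.sum_univ_castSucc, ← add_assoc]
  rfl

theorem first_mid_last_cases {p : Fin (n + 2) → Prop} (h0 : p 0)
    (hm : ∀ i : Fin n, p i.castSucc.succ) (hl : p (Fin.last (n + 1))) (i : Fin (n + 2)) : p i := by
  refine Fin.cases h0 (fun i => ?_) i
  refine Fin.lastCases ?_ (fun i => hm i) i
  rwa [Fin.succ_last]

theorem rev_mid (i : Fin n) : Fin.rev i.castSucc.succ = (Fin.rev i).castSucc.succ := by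
  rw [Fin.rev_succ, Fin.rev_castSucc, Fin.succ_castSucc]

theorem rev_first : Fin.rev (0 : Fin (n + 2)) = Fin.last (n + 1) := rfl

theorem mid_ne_zero (i : Fin n) : i.castSucc.succ ≠ (0 : Fin (n + 2)) := Fin.succ_ne_zero _

theorem mid_ne_last (i : Fin n) : i.castSucc.succ ≠ Fin.last (n + 1) := by
  rw [← Fin.succ_last, Ne, Fin.succ_inj]
  exact Fin.castSucc_ne_last i

theorem zero_ne_last' : (0 : Fin (n + 2)) ≠ Fin.last (n + 1) := (Fin.last_pos).ne

theorem mid_inj {i j : Fin n} :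
    (i.castSucc.succ : Fin (n + 2)) = j.castSucc.succ ↔ i = j := by
  rw [Fin.succ_inj, Fin.castSucc_inj]

/-- The vector with first entry `a`, last entry `b` and middle entries `w`. -/
def bordVec {A : Type*} (a : A) (w : Fin n → A) (b : A) : Fin (n + 2) → A :=
  Fin.cons a (Fin.snoc w b : Fin (n + 1) → A)

@[simp]
theorem bordVec_zero {A : Type*} (a : A) (w : Fin n → A) (b : A) : bordVec a w b 0 = a := rfl

@[simp]
theorem bordVec_mid {A : Type*} (a : A) (w : Fin n → A) (b : A) (i : Fin n) :
    bordVec a w b i.castSucc.succ = w i := by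
  simp [bordVec]

@[simp]
theorem bordVec_last {A : Type*} (a : A) (w : Fin n → A) (b : A) :
    bordVec a w b (Fin.last (n + 1)) = b := by
  simp [bordVec, ← Fin.succ_last]

/-- The Levi element `diag(x, g, x⁻¹)`. -/
def leviElt (x : Rˣ) (g : orthGroup n R) : orthGroup (n + 2) R :=
  orthOfMatrix (Matrix.of (bordVec (bordVec (x : R) 0 0)
      (fun i => bordVec 0 (fun j => entry g i j) 0)
      (bordVec 0 0 ((x⁻¹ : Rˣ) : R)))) fun i j => by
    rw [sum_first_mid_last]
    induction i using first_mid_last_cases with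
    | h0 => induction j using first_mid_last_cases with
      | h0 => simp [rev_mid]
      | hm j => simp [rev_mid]
      | hl => simp [rev_mid]
    | hm i => induction j using first_mid_last_cases with
      | h0 => simp [rev_mid, (mid_ne_zero _).symm]
      | hm j => simp [rev_mid, sum_entry_mul_entry_rev]
      | hl => simp [rev_mid, (mid_ne_last _).symm]
    | hl => induction j using first_mid_last_cases with
      | h0 => simp [rev_mid]
      | hm j => simp [rev_mid]
      | hl => simp [rev_mid]

/-- The lower unipotent element with first column `(1, w, c)`. -/
def lowerUnip (w : Fin n → R) (c : R) (h : c + ∑ i, w i * w (Fin.rev i) + c = 0) :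
    orthGroup (n + 2) R :=
  orthOfMatrix (Matrix.of (bordVec (bordVec 1 0 0)
      (fun i => bordVec (w i) (fun j => if i = j then 1 else 0) 0)
      -- The last row is forced by orthogonality of the middle columns to the first one; `h` is
      -- isotropy of the first column, written without dividing by 2.
      (bordVec c (fun j => - w (Fin.rev j)) 1))) fun i j => by
    rw [sum_first_mid_last]
    induction i using first_mid_last_cases with
    | h0 => induction j using first_mid_last_cases with
      | h0 => simpa [rev_mid] using h
      | hm j => simp [rev_mid, Fin.rev_eq_iff]
      | hl => simp [rev_mid]
    | hm i => induction j using first_mid_last_cases with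
      | h0 => simp [rev_mid, (mid_ne_zero _).symm]
      | hm j =>
        rw [Finset.sum_eq_single i (fun l _ hl => by simp [hl]) (by simp)]
        simp [rev_mid, eq_comm]
      | hl => simp [rev_mid, (mid_ne_last _).symm]
    | hl => induction j using first_mid_last_cases with
      | h0 => simp [rev_mid]
      | hm j => simp [rev_mid]
      | hl => simp [rev_mid]

end Orthogonal

/-! ### The parabolic subgroup -/

section Parabolic

variable {R : Type*} [CommRing R] {n : ℕ}

theorem isParabolicOver_leviElt (x : Rˣ) (g : orthGroup (2 * n) R) :
    IsParabolicOver (leviElt x g) x g where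
  first_column i := by
    induction i using first_mid_last_cases <;> simp [leviElt]
  last_row j := by
    induction j using first_mid_last_cases <;> simp [leviElt]
  first_block := by simp [leviElt]
  last_block := by simp [leviElt]
  middle_block i j := by simp [leviElt]

namespace IsParabolicOver

theorem one : IsParabolicOver (1 : orthGroup (2 * n + 2) R) 1 1 where
  first_column i hi := by simp [entry_one, hi]
  last_row j hj := by simp [entry_one, hj.symm]
  first_block := by simp [entry_one]
  last_block := by simp [entry_one]
  middle_block i j := by simp [entry_one]

theorem mul {p q : orthGroup (2 * n + 2) R} {x y : Rˣ} {g h : orthGroup (2 * n) R}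
    (hp : IsParabolicOver p x g) (hq : IsParabolicOver q y h) :
    IsParabolicOver (p * q) (x * y) (g * h) where
  first_column i hi := by
    rw [entry_mul]
    refine Finset.sum_eq_zero fun l _ => ?_
    by_cases hl : l = 0
    · rw [hl, hp.first_column i hi, zero_mul]
    · rw [hq.first_column l hl, mul_zero]
  last_row j hj := by
    rw [entry_mul]
    refine Finset.sum_eq_zero fun l _ => ?_
    by_cases hl : l = Fin.last (2 * n + 1)
    · rw [hl, hq.last_row j hj, mul_zero]
    · rw [hp.last_row l hl, zero_mul]
  first_block := by
    rw [entry_mul, Finset.sum_eq_single 0 (fun l _ hl => by rw [hq.first_column l hl, mul_zero])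
      (by simp), hp.first_block, hq.first_block, Units.val_mul]
  last_block := by
    rw [entry_mul, Finset.sum_eq_single (Fin.last (2 * n + 1))
      (fun l _ hl => by rw [hp.last_row l hl, zero_mul])
      (by simp), hp.last_block, hq.last_block, ← Units.val_mul, mul_inv]
  middle_block i j := by
    rw [entry_mul, sum_first_mid_last, hp.first_column _ (mid_ne_zero i),
      hq.last_row _ (mid_ne_last j), zero_mul, mul_zero, zero_add, add_zero, entry_mul]
    simp only [hp.middle_block, hq.middle_block]

theorem inv {p : orthGroup (2 * n + 2) R} {x : Rˣ} {g : orthGroup (2 * n) R}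
    (hp : IsParabolicOver p x g) : IsParabolicOver p⁻¹ x⁻¹ g⁻¹ where
  first_column i hi := by
    rw [entry_inv]
    exact hp.last_row _ fun h => hi (by rw [← Fin.rev_inj, h]; rfl)
  last_row j hj := by
    rw [entry_inv, Fin.rev_last]
    exact hp.first_column _ fun h => hj (by rw [← Fin.rev_inj, h]; simp)
  first_block := by rw [entry_inv]; exact hp.last_block
  last_block := by rw [entry_inv, Fin.rev_last, hp.first_block, inv_inv]
  middle_block i j := by
    rw [entry_inv, rev_mid, rev_mid, hp.middle_block, entry_inv]

end IsParabolicOver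

/-- P is the stabiliser of the line of the first basis vector. Up to order, the last row of p is the
first column of p⁻¹, so it vanishes where required; the form then restricts to the middle block. No
field is needed, so this applies directly over the adeles. -/
theorem exists_isParabolicOver_of_first_column (p : orthGroup (2 * n + 2) R)
    (hp : ∀ i, i ≠ 0 → entry p i 0 = 0) : ∃ x g, IsParabolicOver p x g := by
  have h1 : entry p⁻¹ 0 0 * entry p 0 0 = 1 := by
    have h := entry_mul p⁻¹ p 0 0
    rw [inv_mul_cancel, entry_one, if_pos rfl,
      Finset.sum_eq_single 0 (fun l _ hl => by rw [hp l hl, mul_zero]) (by simp)] at h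
    exact h.symm
  have hlast : ∀ j, j ≠ Fin.last (2 * n + 1) → entry p (Fin.last (2 * n + 1)) j = 0 := by
    intro j hj
    have h := entry_mul p⁻¹ p (Fin.rev j) 0
    have hj0 : Fin.rev j ≠ 0 := fun h => hj (by rw [← Fin.rev_inj, h]; simp)
    rw [inv_mul_cancel, entry_one, if_neg hj0,
      Finset.sum_eq_single 0 (fun l _ hl => by rw [hp l hl, mul_zero]) (by simp), entry_inv,
      Fin.rev_rev, rev_first] at h
    calc _ = entry p (Fin.last (2 * n + 1)) j * (entry p⁻¹ 0 0 * entry p 0 0) := by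
          rw [h1, mul_one]
      _ = (entry p (Fin.last (2 * n + 1)) j * entry p 0 0) * entry p⁻¹ 0 0 := by ring
      _ = 0 := by rw [← h, zero_mul]
  refine ⟨⟨entry p 0 0, entry p⁻¹ 0 0, by rw [mul_comm, h1], h1⟩,
    orthOfMatrix (Matrix.of fun i j => entry p i.castSucc.succ j.castSucc.succ) fun i j => ?_,
    hp, hlast, rfl, ?_, fun i j => rfl⟩
  · have h := sum_entry_mul_entry_rev p i.castSucc.succ j.castSucc.succ
    rw [sum_first_mid_last, rev_first, Fin.rev_last, hlast _ (mid_ne_last i),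
      hlast _ (mid_ne_last j), mul_zero, zero_mul, add_zero, zero_add] at h
    simp only [rev_mid, mid_inj] at h
    exact h
  · change _ = entry p⁻¹ 0 0
    rw [entry_inv, rev_first]

end Parabolic


/-! ### The Iwasawa decomposition over a valued field -/

theorem exists_perm_commute_rev {n : ℕ} (i : Fin (n + 2)) (hi : Fin.rev i ≠ i) :
    ∃ π : Equiv.Perm (Fin (n + 2)), (∀ j, π (Fin.rev j) = Fin.rev (π j)) ∧ π 0 = i := by
  have h0 : (0 : Fin (n + 2)) ≠ Fin.rev 0 := zero_ne_last'
  by_cases h1 : i = 0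
  · exact ⟨1, fun j => rfl, h1.symm⟩
  by_cases h2 : i = Fin.rev 0
  · exact ⟨Fin.revPerm, fun j => rfl, h2.symm⟩
  have h3 : Fin.rev i ≠ 0 := fun h => h2 (by rw [← h, Fin.rev_rev])
  -- Both transpositions are needed for compatibility with `Fin.rev`; the cases already removed make
  -- them disjoint, hence commuting.
  refine ⟨Equiv.swap 0 i * Equiv.swap (Fin.rev 0) (Fin.rev i), fun j => ?_, ?_⟩
  · have hc : ∀ a b j : Fin (n + 2),
        Equiv.swap (Fin.rev a) (Fin.rev b) (Fin.rev j) = Fin.rev (Equiv.swap a b j) := by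
      intro a b j
      simp only [Equiv.swap_apply_def, Fin.rev_inj]
      split_ifs <;> rfl
    have hc' : ∀ j : Fin (n + 2), Equiv.swap 0 i (Fin.rev j) =
        Fin.rev (Equiv.swap (Fin.rev 0) (Fin.rev i) j) := fun j => by
      rw [← hc, Fin.rev_rev, Fin.rev_rev]
    have hcomm : Commute (Equiv.swap 0 i) (Equiv.swap (Fin.rev 0) (Fin.rev i)) := by
      refine (Equiv.Perm.disjoint_iff_disjoint_support.2 ?_).commute
      rw [Equiv.Perm.support_swap (Ne.symm h1),
        Equiv.Perm.support_swap (by rwa [Ne, Fin.rev_inj, eq_comm])]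
      have h4 : Fin.last (n + 1) ≠ i := Ne.symm h2
      simp [h3, h4, hi]
    rw [Equiv.Perm.mul_apply, hc, hc', hcomm.eq, Equiv.Perm.mul_apply]
  · rw [Equiv.Perm.mul_apply, Equiv.swap_apply_of_ne_of_ne h0 (Ne.symm h3), Equiv.swap_apply_left]

/-- Local Iwasawa decomposition. The line of h⁻¹e₀ is isotropic; an integral orthogonal k whose
first column spans it satisfies h k e₀ ∈ L e₀. Such a k is a permutation matrix times a lower
unipotent one. -/
theorem exists_integral_mul_first_column {L Γ₀ : Type*} [Field L]
    [LinearOrderedCommGroupWithZero Γ₀] (v : Valuation L Γ₀) {n : ℕ}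
    (h : orthGroup (2 * n + 2) L) :
    ∃ k : orthGroup (2 * n + 2) L, (∀ i j, v (entry k i j) ≤ 1) ∧
      ∀ i, i ≠ 0 → entry (h * k) i 0 = 0 := by
  obtain ⟨i₀, hi₀⟩ := Finite.exists_max fun i => v (entry h⁻¹ i 0)
  have hmul : ∀ i, ∑ l, entry h i l * entry h⁻¹ l 0 = if i = 0 then 1 else 0 := fun i => by
    rw [← entry_mul, mul_inv_cancel, entry_one]
  have hne : entry h⁻¹ i₀ 0 ≠ 0 := by
    intro h0
    have hz : ∀ i, entry h⁻¹ i 0 = 0 := fun i => by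
      have := hi₀ i
      simp only [h0, map_zero, le_zero_iff, map_eq_zero] at this
      exact this
    simpa [hz] using hmul 0
  -- The size 2n + 2 is even, so `Fin.rev` has no fixed index.
  obtain ⟨π, hπ, hπ0⟩ := exists_perm_commute_rev i₀ (by
    intro h
    have := congrArg Fin.val h
    rw [Fin.val_rev] at this
    omega)
  -- The vector h⁻¹e₀, permuted and scaled so that its entry of largest valuation becomes a leading
  -- 1; all entries are then integral.
  let y : Fin (2 * n + 2) → L := fun j => entry h⁻¹ (π j) 0 / entry h⁻¹ i₀ 0
  have hy0 : y 0 = 1 := by simp only [y, hπ0, div_self hne]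
  have hy1 : ∀ j, v (y j) ≤ 1 := fun j => by
    simp only [y, map_div₀]
    exact div_le_one_of_le₀ (hi₀ _) zero_le
  have hiso : ∑ j, y j * y (Fin.rev j) = 0 := by
    have h1 : ∑ j, entry h⁻¹ (π j) 0 * entry h⁻¹ (π (Fin.rev j)) 0 = 0 := by
      simp only [hπ]
      rw [Equiv.sum_comp π fun l => entry h⁻¹ l 0 * entry h⁻¹ (Fin.rev l) 0,
        sum_entry_mul_entry_rev, rev_first, if_neg zero_ne_last']
    simp only [y, div_mul_div_comm]
    rw [← Finset.sum_div, h1, zero_div]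
  have hlow : y (Fin.last (2 * n + 1)) + ∑ i : Fin (2 * n), y i.castSucc.succ *
      y (Fin.rev i).castSucc.succ + y (Fin.last (2 * n + 1)) = 0 := by
    rw [sum_first_mid_last, Fin.rev_last, rev_first, hy0, one_mul, mul_one] at hiso
    simpa only [rev_mid] using hiso
  let u := lowerUnip (fun i : Fin (2 * n) => y i.castSucc.succ) _ hlow
  have hu : ∀ j, entry u j 0 = y j := fun j => by
    induction j using first_mid_last_cases with
    | h0 => simp [u, lowerUnip, hy0]
    | hm j => simp [u, lowerUnip]
    | hl => simp [u, lowerUnip]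
  have hk : ∀ i j, entry (permOrth L π hπ * u) (π i) j = entry u i j := fun i j => by
    simp [entry_mul, entry_permOrth]
  refine ⟨permOrth L π hπ * u, fun i j => ?_, fun i hi => ?_⟩
  · obtain ⟨i, rfl⟩ := π.surjective i
    rw [hk]
    induction i using first_mid_last_cases with
    | h0 => induction j using first_mid_last_cases <;> simp [u, lowerUnip]
    | hm i => induction j using first_mid_last_cases with
      | h0 => simpa [u, lowerUnip] using hy1 _
      | hm j => simp only [u, lowerUnip, entry_orthOfMatrix, Matrix.of_apply, bordVec_mid]
                split_ifs <;> simp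
      | hl => simp [u, lowerUnip]
    | hl => induction j using first_mid_last_cases with
      | h0 => simpa [u, lowerUnip] using hy1 _
      | hm j => simpa [u, lowerUnip, Valuation.map_neg] using hy1 _
      | hl => simp [u, lowerUnip]
  · rw [entry_mul, ← Equiv.sum_comp π]
    simp only [hk, hu, y, ← mul_div_assoc]
    rw [← Finset.sum_div, Equiv.sum_comp π fun l => entry h i l * entry h⁻¹ l 0, hmul, if_neg hi,
      zero_div]


/-! ### Invariants of induced representations and double cosets -/

section Induction

variable {E G M V : Type*} [Field E] [Group G] [Group M] [AddCommGroup V] [Module E V]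

/-- The functions `f : G → V` that are equivariant under a correspondence `S ⊆ G × M` on the left
and invariant under `K` on the right. -/
def equivariantFunctions (S : Subgroup (G × M)) (K : Subgroup G) (τ : Representation E M V) :
    Submodule E (G → V) where
  carrier := {f | (∀ s ∈ S, ∀ h, f (s.1 * h) = τ s.2 (f h)) ∧ ∀ u ∈ K, ∀ h, f (h * u) = f h}
  zero_mem' := ⟨fun s _ h => by simp, fun u _ h => rfl⟩
  add_mem' := by
    rintro f₁ f₂ ⟨h1, hf₁⟩ ⟨h2, hf₂⟩
    exact ⟨fun s hs h => by simp [h1 s hs h, h2 s hs h],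
      fun u hu h => by simp [hf₁ u hu h, hf₂ u hu h]⟩
  smul_mem' := by
    rintro c f ⟨h1, hf⟩
    exact ⟨fun s hs h => by simp [h1 s hs h], fun u hu h => by simp [hf u hu h]⟩

/-- The vectors fixed by the image in `M` of the part of `S` that lies over `K`. -/
def correspondenceInvariants (S : Subgroup (G × M)) (K : Subgroup G) (τ : Representation E M V) :
    Submodule E V where
  carrier := {w | ∀ s ∈ S, s.1 ∈ K → τ s.2 w = w}
  zero_mem' := fun s _ _ => map_zero _
  add_mem' := fun h1 h2 s hs hK => by rw [map_add, h1 s hs hK, h2 s hs hK]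
  smul_mem' := fun c w h s hs hK => by rw [map_smul, h s hs hK]

variable (S : Subgroup (G × M)) (K : Subgroup G)

/-- The double cosets of the image of `S` in `G` and of `K`. -/
abbrev CorrCosets : Type _ :=
  DoubleCoset.Quotient ((S.map (MonoidHom.fst G M) : Subgroup G) : Set G) (K : Set G)

/-- The double coset of an element of `G`. -/
def corrMk (h : G) : CorrCosets S K := DoubleCoset.mk _ _ h

theorem corrMk_eq {h h' : G} :
    corrMk S K h = corrMk S K h' ↔ ∃ s ∈ S, ∃ u ∈ K, h' = s.1 * h * u := by
  rw [corrMk, corrMk, DoubleCoset.eq]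
  simp [Subgroup.mem_map]

variable {S K} {K₀ : Subgroup G}

/-- Representatives are taken in K₀ because K is only normalised by K₀. -/
theorem exists_corr_representatives (hG : ∀ h : G, ∃ s ∈ S, s.1 * h ∈ K₀) :
    ∃ r : CorrCosets S K → G, ∀ q, r q ∈ K₀ ∧ corrMk S K (r q) = q := by
  refine Classical.axiomOfChoice (r := fun q r => r ∈ K₀ ∧ corrMk S K r = q) fun q => ?_
  obtain ⟨h, rfl⟩ : ∃ h, corrMk S K h = q := Quotient.exists_rep q
  obtain ⟨s, hs, hk⟩ := hG h
  exact ⟨s.1 * h, hk, ((corrMk_eq S K).2 ⟨s, hs, 1, K.one_mem, (mul_one _).symm⟩).symm⟩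

theorem finite_corrCosets (hG : ∀ h : G, ∃ s ∈ S, s.1 * h ∈ K₀) (hfin : K.relIndex K₀ ≠ 0) :
    Finite (CorrCosets S K) := by
  have : (K.subgroupOf K₀).FiniteIndex := ⟨hfin⟩
  have : Finite (K₀ ⧸ K.subgroupOf K₀) := inferInstance
  refine Finite.of_surjective (α := K₀ ⧸ K.subgroupOf K₀)
    (Quotient.lift (fun a : K₀ => corrMk S K a) fun a b hab => ?_) fun q => ?_
  · rw [corrMk_eq]
    refine ⟨1, S.one_mem, (a⁻¹ * b : K₀), ?_, by simp⟩
    exact (QuotientGroup.leftRel_apply (s := K.subgroupOf K₀)).1 hab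
  · obtain ⟨r, hr⟩ := exists_corr_representatives (K := K) hG
    exact ⟨QuotientGroup.mk ⟨r q, (hr q).1⟩, (hr q).2⟩

/-- Mackey's description: f corresponds to its values at representatives r ∈ K₀. Since r normalises
K, the target space does not depend on the double coset. -/
theorem nonempty_equivariantFunctions_equiv (hG : ∀ h : G, ∃ s ∈ S, s.1 * h ∈ K₀)
    (hK : ∀ a ∈ K₀, ∀ b ∈ K, a * b * a⁻¹ ∈ K) (τ : Representation E M V) :
    Nonempty (equivariantFunctions S K τ ≃ₗ[E]
      (CorrCosets S K → correspondenceInvariants S K τ)) := by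
  obtain ⟨r, hr⟩ := exists_corr_representatives (K := K) hG
  -- For s over K, τ(s) f(r) = f(s r) = f(r · r⁻¹ s r) = f(r).
  have hval : ∀ f : equivariantFunctions S K τ, ∀ q,
      f.1 (r q) ∈ correspondenceInvariants S K τ := fun f q s hs hsK => by
    rw [← f.2.1 s hs]
    have h := f.2.2 _ (hK _ (K₀.inv_mem (hr q).1) _ hsK) (r q)
    rwa [inv_inv, ← mul_assoc, mul_inv_cancel_left] at h
  have hrep : ∀ h, ∃ s ∈ S, ∃ u ∈ K, h = s.1 * r (corrMk S K h) * u := fun h =>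
    (corrMk_eq S K).1 (hr (corrMk S K h)).2
  let Φ : equivariantFunctions S K τ →ₗ[E] (CorrCosets S K → correspondenceInvariants S K τ) :=
    { toFun := fun f q => ⟨f.1 (r q), hval f q⟩
      map_add' := fun _ _ => rfl
      map_smul' := fun _ _ => rfl }
  refine ⟨LinearEquiv.ofBijective Φ ⟨fun f f' hff' => ?_, fun w => ?_⟩⟩
  · refine Subtype.ext (funext fun h => ?_)
    obtain ⟨s, hs, u, hu, e⟩ := hrep h
    have h1 : f.1 (r (corrMk S K h)) = f'.1 (r (corrMk S K h)) :=
      congrArg Subtype.val (congrFun hff' (corrMk S K h))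
    rw [e, f.2.2 u hu, f'.2.2 u hu, f.2.1 s hs, f'.2.1 s hs, h1]
  · choose a ha u hu hau using hrep
    -- Well-definedness of the extension: if h = a r u = s r u', then a⁻¹ s = r (u u'⁻¹) r⁻¹ lies in
    -- K, so a⁻¹ s fixes the prescribed value.
    have key : ∀ h, ∀ s ∈ S, ∀ u' ∈ K, h = s.1 * r (corrMk S K h) * u' →
        τ (a h).2 (w (corrMk S K h)) = τ s.2 (w (corrMk S K h)) := fun h s hs u' hu' e => by
      have hmem : ((a h)⁻¹ * s).1 ∈ K := by
        have h1 := hK _ (hr (corrMk S K h)).1 _ (K.mul_mem (hu h) (K.inv_mem hu'))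
        have h2 : s.1 = h * u'⁻¹ * (r (corrMk S K h))⁻¹ := by
          rw [eq_mul_inv_iff_mul_eq, eq_mul_inv_iff_mul_eq, ← e]
        have h3 : (a h).1⁻¹ * h = r (corrMk S K h) * u h := by
          rw [inv_mul_eq_iff_eq_mul, ← mul_assoc, ← hau h]
        rw [Prod.fst_mul, Prod.fst_inv, h2, ← mul_assoc, ← mul_assoc, h3]
        rwa [← mul_assoc] at h1
      have h4 := (w (corrMk S K h)).2 _ (S.mul_mem (S.inv_mem (ha h)) hs) hmem
      calc _ = τ (a h).2 (τ ((a h)⁻¹ * s).2 (w (corrMk S K h))) := by rw [h4]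
        _ = _ := by rw [← Module.End.mul_apply, ← map_mul, ← Prod.snd_mul, mul_inv_cancel_left]
    refine ⟨⟨fun h => τ (a h).2 (w (corrMk S K h)), fun s hs h => ?_, fun u' hu' h => ?_⟩, ?_⟩
    · beta_reduce
      have hq : corrMk S K (s.1 * h) = corrMk S K h :=
        ((corrMk_eq S K).2 ⟨s, hs, 1, K.one_mem, (mul_one _).symm⟩).symm
      have h1 := key (s.1 * h) (s * a h) (S.mul_mem hs (ha h)) (u h) (hu h) (by
        rw [hq, Prod.fst_mul, mul_assoc, mul_assoc, ← mul_assoc (a h).1, ← hau h])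
      rw [h1, hq, Prod.snd_mul, map_mul, Module.End.mul_apply]
    · beta_reduce
      have hq : corrMk S K (h * u') = corrMk S K h :=
        ((corrMk_eq S K).2 ⟨1, S.one_mem, u', hu', by simp⟩).symm
      have h1 := key (h * u') (a h) (ha h) (u h * u') (K.mul_mem (hu h) hu') (by
        rw [hq, ← mul_assoc, ← hau h])
      rw [h1, hq]
    · refine funext fun q => Subtype.ext ?_
      have h1 := key (r q) 1 S.one_mem 1 K.one_mem (by rw [(hr q).2]; simp)
      rw [(hr q).2] at h1
      change τ (a (r q)).2 (w (corrMk S K (r q))) = w q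
      rw [(hr q).2, h1]
      simp

/-- The coset count does not involve τ, which is what permits comparing two different τ. -/
theorem finite_and_finrank_equivariantFunctions (hG : ∀ h : G, ∃ s ∈ S, s.1 * h ∈ K₀)
    (hK : ∀ a ∈ K₀, ∀ b ∈ K, a * b * a⁻¹ ∈ K) (hfin : K.relIndex K₀ ≠ 0)
    (τ : Representation E M V) [Module.Finite E (correspondenceInvariants S K τ)] :
    Module.Finite E (equivariantFunctions S K τ) ∧
      Module.finrank E (equivariantFunctions S K τ) =
        Nat.card (CorrCosets S K) * Module.finrank E (correspondenceInvariants S K τ) := by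
  have := finite_corrCosets (K := K) hG hfin
  have := Fintype.ofFinite (CorrCosets S K)
  obtain ⟨e⟩ := nonempty_equivariantFunctions_equiv hG hK τ
  refine ⟨Module.Finite.equiv e.symm, ?_⟩
  rw [e.finrank_eq, Module.finrank_pi_fintype]
  simp

end Induction

/-! ### Parabolic induction as a case of the correspondence formalism -/

section AlgInd

variable {E V R : Type*} [Field E] [AddCommGroup V] [Module E V] [CommRing R] {n : ℕ}

/-- The correspondence between `P(R) ⊆ O(2n+2)(R)` and its Levi quotient. -/
def parabolicCorr (n : ℕ) (R : Type*) [CommRing R] :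
    Subgroup (orthGroup (2 * n + 2) R × (Rˣ × orthGroup (2 * n) R)) where
  carrier := {s | IsParabolicOver s.1 s.2.1 s.2.2}
  one_mem' := IsParabolicOver.one
  mul_mem' := IsParabolicOver.mul
  inv_mem' := IsParabolicOver.inv

variable [TopologicalSpace R] [IsTopologicalRing R]

/-- The smoothness condition in `indSpace` is automatic for K-invariant functions: the open subgroup
K is a witness. -/
theorem map_subtype_fixedBy_algInd (τ : Representation E (Rˣ × orthGroup (2 * n) R) V)
    {K : Subgroup (orthGroup (2 * n + 2) R)}
    (hK : IsOpen (K : Set (orthGroup (2 * n + 2) R))) :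
    (fixedBy (algInd τ) K).map (indSpace τ).subtype =
      equivariantFunctions (parabolicCorr n R) K τ := by
  ext f
  constructor
  · rintro ⟨f, hf, rfl⟩
    refine ⟨fun s hs h => f.2.1 s.1 s.2.1 s.2.2 hs h, fun u hu h => ?_⟩
    exact congrFun (congrArg Subtype.val (hf ⟨u, hu⟩)) h
  · rintro ⟨h1, h2⟩
    exact ⟨⟨f, fun p x g hp h => h1 (p, x, g) hp h, K, hK, h2⟩,
      fun u => Subtype.ext (funext fun h => h2 u.1 u.2 h), rfl⟩

/-- The `K`-invariants of `ᵃInd_P^G τ` as functions on `G`. -/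
noncomputable def fixedByAlgIndEquiv (τ : Representation E (Rˣ × orthGroup (2 * n) R) V)
    {K : Subgroup (orthGroup (2 * n + 2) R)}
    (hK : IsOpen (K : Set (orthGroup (2 * n + 2) R))) :
    fixedBy (algInd τ) K ≃ₗ[E] equivariantFunctions (parabolicCorr n R) K τ :=
  (Submodule.equivMapOfInjective _ (indSpace τ).injective_subtype _).trans
    (LinearEquiv.ofEq _ _ (map_subtype_fixedBy_algInd τ hK))

end AlgInd


/-! ### Local congruence subgroups -/

section LocalCongruence

variable {F : Type*} [Field F] [NumberField F] {m : ℕ} {v : HeightOneSpectrum (𝓞 F)} {k : ℕ}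

theorem mem_localCongruence {g : orthGroup m (v.adicCompletion F)} :
    g ∈ localCongruence m v k ↔ ∀ i j, Valued.v (entry g i j - if i = j then 1 else 0) ≤
      WithZero.exp (-(k : ℤ)) := Iff.rfl

theorem mem_localCongruence_zero {g : orthGroup m (v.adicCompletion F)} :
    g ∈ localCongruence m v 0 ↔ ∀ i j, Valued.v (entry g i j) ≤ 1 := by
  have hδ : ∀ i j : Fin m, Valued.v (if i = j then (1 : v.adicCompletion F) else 0) ≤ 1 :=
    fun i j => by split_ifs <;> simp
  rw [mem_localCongruence]
  simp only [Nat.cast_zero, neg_zero, WithZero.exp_zero]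
  refine forall₂_congr fun i j => ⟨fun h => ?_, fun h => ?_⟩
  · rw [← sub_add_cancel (entry g i j) (if i = j then 1 else 0)]
    exact (Valuation.map_add _ _ _).trans (max_le h (hδ i j))
  · exact (Valuation.map_sub _ _ _).trans (max_le h (hδ i j))

theorem localCongruence_le_zero : localCongruence m v k ≤ localCongruence m v 0 := by
  intro g hg i j
  refine (hg i j).trans ?_
  rw [WithZero.exp_le_exp]
  simp

/-- a b a⁻¹ − 1 = a (b − 1) a⁻¹, with a and a⁻¹ integral. -/
theorem conj_mem_localCongruence {a b : orthGroup m (v.adicCompletion F)}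
    (ha : a ∈ localCongruence m v 0) (hb : b ∈ localCongruence m v k) :
    a * b * a⁻¹ ∈ localCongruence m v k := by
  intro i j
  have h1 : entry (a * b * a⁻¹) i j - (if i = j then 1 else 0) =
      ∑ s, (∑ l, entry a i l * (entry b l s - if l = s then 1 else 0)) * entry a⁻¹ s j := by
    have h2 : (if i = j then (1 : v.adicCompletion F) else 0) =
        ∑ s, entry a i s * entry a⁻¹ s j := by
      rw [← entry_mul, mul_inv_cancel, entry_one]
    rw [h2, entry_mul, ← Finset.sum_sub_distrib]
    refine Finset.sum_congr rfl fun s _ => ?_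
    rw [← sub_mul, entry_mul]
    simp [mul_sub, Finset.sum_sub_distrib]
  rw [h1]
  refine Valuation.map_sum_le _ fun s _ => ?_
  rw [map_mul]
  refine (mul_le_of_le_one_right' (mem_localCongruence_zero.1 (inv_mem ha) s j)).trans ?_
  refine Valuation.map_sum_le _ fun l _ => ?_
  rw [map_mul]
  exact (mul_le_of_le_one_left' (mem_localCongruence_zero.1 ha i l)).trans (hb l s)

theorem isOpen_valued_le (v : HeightOneSpectrum (𝓞 F)) (k : ℕ) :
    IsOpen {y : v.adicCompletion F | Valued.v y ≤ WithZero.exp (-(k : ℤ))} := by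
  obtain ⟨c, hc⟩ := v.valuedAdicCompletion_surjective F (WithZero.exp (-(k : ℤ)))
  have hc0 : Valued.v c ≠ 0 := hc ▸ WithZero.exp_ne_zero
  have h : {y : v.adicCompletion F | Valued.v y ≤ WithZero.exp (-(k : ℤ))} =
      (fun y => y * c⁻¹) ⁻¹' (v.adicCompletionIntegers F : Set (v.adicCompletion F)) := by
    ext y
    simp only [Set.mem_preimage, SetLike.mem_coe, HeightOneSpectrum.mem_adicCompletionIntegers,
      map_mul, map_inv₀, Set.mem_ofPred_eq]
    rw [← div_eq_mul_inv, div_le_one₀ (zero_lt_iff.2 hc0), hc]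
  rw [h]
  exact (Valued.isOpen_valuationSubring (v.adicCompletion F)).preimage (continuous_mul_const c⁻¹)

/-- Two approximations: x by an element of F, by density, then that v-integral element by an element
of 𝓞 F. -/
theorem exists_integer_valued_sub_le (x : v.adicCompletion F) (hx : Valued.v x ≤ 1) (k : ℕ) :
    ∃ a : 𝓞 F, Valued.v (x - algebraMap F (v.adicCompletion F) (algebraMap (𝓞 F) F a)) ≤
      WithZero.exp (-(k : ℤ)) := by
  have hval : ∀ y : F, Valued.v (algebraMap F (v.adicCompletion F) y) = v.valuation F y :=
    fun y => HeightOneSpectrum.valuedAdicCompletion_eq_valuation' v y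
  have hk : WithZero.exp (-(k : ℤ)) ≤ 1 := by
    rw [← WithZero.exp_zero, WithZero.exp_le_exp]
    omega
  obtain ⟨y, hy⟩ := (HeightOneSpectrum.denseRange_algebraMap F v).exists_mem_open
    ((isOpen_valued_le v k).preimage (continuous_const.sub continuous_id : Continuous (x - ·)))
    ⟨x, by simp⟩
  have hy' : Valued.v (x - algebraMap F (v.adicCompletion F) y) ≤ WithZero.exp (-(k : ℤ)) := hy
  have hy1 : v.valuation F y ≤ 1 := by
    rw [← hval, ← sub_sub_cancel x (algebraMap F (v.adicCompletion F) y)]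
    exact (Valuation.map_sub _ _ _).trans (max_le hx (hy'.trans hk))
  obtain ⟨a, ha⟩ := v.exists_valuation_sub_lt_of_integer hy1
    (Units.mk0 (WithZero.exp (-(k : ℤ))) WithZero.exp_ne_zero)
  refine ⟨a, ?_⟩
  rw [← hval, map_sub, Valuation.map_sub_swap] at ha
  rw [← sub_add_sub_cancel x (algebraMap F (v.adicCompletion F) y)]
  exact (Valuation.map_add _ _ _).trans (max_le hy' ha.le)

theorem exists_finite_classification (v : HeightOneSpectrum (𝓞 F)) (k : ℕ) :
    ∃ (N : ℕ) (c : v.adicCompletion F → Fin N), ∀ x y, Valued.v x ≤ 1 →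
      Valued.v y ≤ 1 → c x = c y → Valued.v (x - y) ≤ WithZero.exp (-(k : ℤ)) := by
  classical
  choose a ha using fun (x : v.adicCompletion F) (hx : Valued.v x ≤ 1) =>
    exists_integer_valued_sub_le x hx k
  have : Finite (𝓞 F ⧸ v.asIdeal ^ k) :=
    Ring.HasFiniteQuotients.finiteQuotient (pow_ne_zero _ v.ne_bot)
  obtain ⟨N, ⟨e⟩⟩ := Finite.exists_equiv_fin (𝓞 F ⧸ v.asIdeal ^ k)
  refine ⟨N, fun x => e (if hx : Valued.v x ≤ 1 then Ideal.Quotient.mk _ (a x hx) else 0),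
    fun x y hx hy hxy => ?_⟩
  rw [e.injective.eq_iff, dif_pos hx, dif_pos hy, Ideal.Quotient.eq, ← HeightOneSpectrum.intValuation_le_pow_iff_mem,
    ← HeightOneSpectrum.valuation_of_algebraMap (K := F)] at hxy
  have h : Valued.v (algebraMap F (v.adicCompletion F) (algebraMap (𝓞 F) F (a x hx - a y hy))) ≤
      WithZero.exp (-(k : ℤ)) :=
    (HeightOneSpectrum.valuedAdicCompletion_eq_valuation' v _).trans_le hxy
  have hy' := ha y hy
  rw [Valuation.map_sub_swap] at hy'
  rw [map_sub, map_sub] at h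
  have hsum : x - y = (x - algebraMap F (v.adicCompletion F) (algebraMap (𝓞 F) F (a x hx))) +
      (algebraMap F (v.adicCompletion F) (algebraMap (𝓞 F) F (a x hx)) -
        algebraMap F (v.adicCompletion F) (algebraMap (𝓞 F) F (a y hy))) +
      (algebraMap F (v.adicCompletion F) (algebraMap (𝓞 F) F (a y hy)) - y) := by ring
  rw [hsum]
  exact (Valuation.map_add _ _ _).trans (max_le
    ((Valuation.map_add _ _ _).trans (max_le (ha x hx) h)) hy')

/-- A coset is determined by the labels of the entries of a representative, as g⁻¹g' − 1 = g⁻¹(g' −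
g). -/
theorem localCongruence_relIndex_ne_zero (m : ℕ) (v : HeightOneSpectrum (𝓞 F)) (k : ℕ) :
    (localCongruence m v k).relIndex (localCongruence m v 0) ≠ 0 := by
  obtain ⟨N, c, hc⟩ := exists_finite_classification v k
  have hinj : Function.Injective fun
      (q : localCongruence m v 0 ⧸ (localCongruence m v k).subgroupOf (localCongruence m v 0))
      (i j : Fin m) => c (entry q.out.1 i j) := by
    intro q q' hqq'
    rw [← q.out_eq', ← q'.out_eq']
    refine QuotientGroup.eq.2 ?_
    rw [Subgroup.mem_subgroupOf, mem_localCongruence]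
    intro i j
    have h1 : entry ((q.out⁻¹ * q'.out : localCongruence m v 0) :
          orthGroup m (v.adicCompletion F)) i j - (if i = j then 1 else 0) =
        ∑ l, entry q.out.1⁻¹ i l * (entry q'.out.1 l j - entry q.out.1 l j) := by
      rw [← entry_one, ← inv_mul_cancel q.out.1]
      simp only [Subgroup.coe_mul, Subgroup.coe_inv, entry_mul, mul_sub, Finset.sum_sub_distrib]
    rw [h1]
    refine Valuation.map_sum_le _ fun l _ => ?_
    rw [map_mul]
    refine (mul_le_of_le_one_left' (mem_localCongruence_zero.1 (inv_mem q.out.2) i l)).trans ?_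
    exact hc _ _ (mem_localCongruence_zero.1 q'.out.2 l j) (mem_localCongruence_zero.1 q.out.2 l j)
      (congrFun (congrFun hqq' l) j).symm
  have : Finite (localCongruence m v 0 ⧸
      (localCongruence m v k).subgroupOf (localCongruence m v 0)) := Finite.of_injective _ hinj
  exact Subgroup.finiteIndex_of_finite_quotient.index_ne_zero

end LocalCongruence

/-! ### Level subgroups -/

section Level

variable {F : Type*} [Field F] [NumberField F] {m n : ℕ} {k : HeightOneSpectrum (𝓞 F) →₀ ℕ}

theorem mem_levelSubgroup {g : orthGroup m (FinAdele F)} :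
    g ∈ levelSubgroup m k ↔
      ∀ v, orthMap m (adeleProj v) g ∈ localCongruence m v (k v) := by
  simp [levelSubgroup, Subgroup.mem_iInf]

theorem mem_levelSubgroup_iff_entry {g : orthGroup m (FinAdele F)} :
    g ∈ levelSubgroup m k ↔
      ∀ v i j, Valued.v (adeleProj v (entry g i j) - if i = j then 1 else 0) ≤
        WithZero.exp (-(k v : ℤ)) := mem_levelSubgroup

theorem conj_mem_levelSubgroup {a b : orthGroup m (FinAdele F)}
    (ha : a ∈ levelSubgroup m 0) (hb : b ∈ levelSubgroup m k) :
    a * b * a⁻¹ ∈ levelSubgroup m k := by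
  rw [mem_levelSubgroup] at *
  intro v
  rw [map_mul, map_mul, map_inv]
  exact conj_mem_localCongruence (ha v) (hb v)

/-- Inside K₀ only the finitely many places in the support of k impose a condition, each of finite
index. -/
theorem levelSubgroup_relIndex_ne_zero (m : ℕ) (k : HeightOneSpectrum (𝓞 F) →₀ ℕ) :
    (levelSubgroup m k).relIndex (levelSubgroup m 0) ≠ 0 := by
  have h0 : levelSubgroup m 0 ⊓ (⨅ v : k.support, (localCongruence m v.1 (k v)).comap
      (orthMap m (adeleProj v.1))) ≤ levelSubgroup m k := by
    rintro g ⟨hg0, hg⟩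
    rw [mem_levelSubgroup]
    intro v
    by_cases hv : k v = 0
    · rw [hv]
      exact mem_levelSubgroup.1 hg0 v
    · exact Subgroup.mem_iInf.1 hg ⟨v, Finsupp.mem_support_iff.2 hv⟩
  refine fun h => ?_
  refine (Subgroup.relIndex_inf_ne_zero (L := levelSubgroup m 0) (H := levelSubgroup m 0)
    (K := ⨅ v : k.support, (localCongruence m v.1 (k v)).comap (orthMap m (adeleProj v.1)))
    (by simp) (Subgroup.relIndex_iInf_ne_zero fun v => ?_))
    (Subgroup.relIndex_eq_zero_of_le_left h0 h)
  refine fun h' => Subgroup.relIndex_comap_ne_zero (orthMap m (adeleProj v.1))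
    (localCongruence_relIndex_ne_zero m v.1 (k v)) (Subgroup.relIndex_eq_zero_of_le_right ?_ h')
  exact fun g hg => mem_levelSubgroup.1 hg v.1

theorem continuous_adeleProj (v : HeightOneSpectrum (𝓞 F)) :
    Continuous (adeleProj v : FinAdele F → v.adicCompletion F) :=
  RestrictedProduct.continuous_eval v

theorem isOpen_forall_valued_le (k : HeightOneSpectrum (𝓞 F) →₀ ℕ) :
    IsOpen {a : FinAdele F | ∀ v, Valued.v (adeleProj v a) ≤ WithZero.exp (-(k v : ℤ))} := by
  have h : {a : FinAdele F | ∀ v, Valued.v (adeleProj v a) ≤ WithZero.exp (-(k v : ℤ))} =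
      {a : FinAdele F | ∀ v, a.1 v ∈ (v.adicCompletionIntegers F : Set (v.adicCompletion F))} ∩
      ⋂ v ∈ k.support, adeleProj v ⁻¹' {y | Valued.v y ≤ WithZero.exp (-(k v : ℤ))} := by
    ext a
    simp only [Set.mem_inter_iff, Set.mem_iInter, Set.mem_preimage, Set.mem_ofPred_eq,
      SetLike.mem_coe, HeightOneSpectrum.mem_adicCompletionIntegers]
    refine ⟨fun ha => ⟨fun v => (ha v).trans ?_, fun v _ => ha v⟩, fun ha v => ?_⟩
    · rw [← WithZero.exp_zero, WithZero.exp_le_exp]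
      omega
    · by_cases hv : k v = 0
      · rw [hv, Nat.cast_zero, neg_zero, WithZero.exp_zero]
        exact ha.1 v
      · exact ha.2 v (Finsupp.mem_support_iff.2 hv)
  rw [h]
  refine IsOpen.inter (RestrictedProduct.isOpen_forall_mem fun v =>
    Valued.isOpen_valuationSubring _) ?_
  exact isOpen_biInter_finset fun v _ => (isOpen_valued_le v (k v)).preimage
    (continuous_adeleProj v)

theorem continuous_entry {R : Type*} [CommRing R] [TopologicalSpace R] (i j : Fin m) :
    Continuous fun g : orthGroup m R => entry g i j :=
  (Units.continuous_val.comp continuous_subtype_val).matrix_elem i j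

theorem isOpen_levelSubgroup (m : ℕ) (k : HeightOneSpectrum (𝓞 F) →₀ ℕ) :
    IsOpen (levelSubgroup m k : Set (orthGroup m (FinAdele F))) := by
  have h : (levelSubgroup m k : Set (orthGroup m (FinAdele F))) =
      ⋂ i, ⋂ j, (fun g => entry g i j - if i = j then 1 else 0) ⁻¹'
        {a : FinAdele F | ∀ v, Valued.v (adeleProj v a) ≤ WithZero.exp (-(k v : ℤ))} := by
    ext g
    simp only [SetLike.mem_coe, mem_levelSubgroup_iff_entry, Set.mem_iInter, Set.mem_preimage,
      Set.mem_ofPred_eq, map_sub, apply_ite (adeleProj _), map_one, map_zero]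
    exact ⟨fun h i j v => h v i j, fun h v i j => h i j v⟩
  rw [h]
  exact isOpen_iInter_of_finite fun i => isOpen_iInter_of_finite fun j =>
    (isOpen_forall_valued_le k).preimage ((continuous_entry i j).sub continuous_const)

/-- There is an element of `O(m)(𝔸_{F,f})` with given integral local components. -/
theorem exists_mem_levelSubgroup_of_local (g : ∀ v : HeightOneSpectrum (𝓞 F),
    orthGroup m (v.adicCompletion F)) (hg : ∀ v, g v ∈ localCongruence m v 0) :
    ∃ a ∈ levelSubgroup m (0 : HeightOneSpectrum (𝓞 F) →₀ ℕ),
      ∀ v, orthMap m (adeleProj v) a = g v := by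
  let A : Matrix (Fin m) (Fin m) (FinAdele F) := fun i j =>
    ⟨fun v => entry (g v) i j, Filter.Eventually.of_forall fun v =>
      (HeightOneSpectrum.mem_adicCompletionIntegers _ _ _).2
        (mem_localCongruence_zero.1 (hg v) i j)⟩
  have hA : ∀ v i j, adeleProj v (A i j) = entry (g v) i j := fun _ _ _ => rfl
  have hext : ∀ a b : FinAdele F, (∀ v, adeleProj v a = adeleProj v b) → a = b :=
    fun a b h => FiniteAdeleRing.ext _ h
  let a : orthGroup m (FinAdele F) := orthOfMatrix A fun i j => hext _ _ fun v => by
    simp only [map_sum, map_mul, hA, sum_entry_mul_entry_rev, apply_ite (adeleProj v), map_one,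
      map_zero]
  have ha : ∀ v, orthMap m (adeleProj v) a = g v := fun v => orthGroup_ext fun i j => rfl
  exact ⟨a, mem_levelSubgroup.2 fun v => by rw [ha]; exact hg v, ha⟩

/-- The Iwasawa decomposition `G_f = P_f K₀`, with `K₀ = ∏_v O(2n+2)(𝒪_v)`. -/
theorem iwasawa (h : orthGroup (2 * n + 2) (FinAdele F)) :
    ∃ s ∈ parabolicCorr n (FinAdele F), s.1 * h ∈ levelSubgroup (2 * n + 2) 0 := by
  choose g hg hgh using fun v : HeightOneSpectrum (𝓞 F) =>
    exists_integral_mul_first_column (Valued.v : Valuation (v.adicCompletion F) _)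
      (orthMap (2 * n + 2) (adeleProj v) h)
  -- The local factors are integral at every place, so they glue to an adelic matrix.
  obtain ⟨a, ha, hag⟩ := exists_mem_levelSubgroup_of_local g
    fun v => mem_localCongruence_zero.2 (hg v)
  obtain ⟨x, y, hxy⟩ := exists_isParabolicOver_of_first_column (h * a) fun i hi =>
    FiniteAdeleRing.ext _ fun v => by
      have h1 := hgh v i hi
      rw [← hag, ← map_mul] at h1
      exact h1
  refine ⟨((h * a)⁻¹, (x⁻¹, y⁻¹)), hxy.inv, ?_⟩
  simpa using inv_mem ha

end Level


/-! ### Vectors of the inducing representations fixed by the level subgroup of the Levi -/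

section LeviInvariants

variable {F : Type*} [Field F] [NumberField F] {E V : Type*} [Field E] [AddCommGroup V]
  [Module E V] {n : ℕ} {k : HeightOneSpectrum (𝓞 F) →₀ ℕ}

/-- The vectors fixed by the part of the Levi quotient that comes from `K_f ∩ P_f`. -/
noncomputable abbrev leviInvariants (τ : Representation E ((FinAdele F)ˣ × orthGroup (2 * n) (FinAdele F)) V)
    (k : HeightOneSpectrum (𝓞 F) →₀ ℕ) : Submodule E V :=
  correspondenceInvariants (parabolicCorr n (FinAdele F)) (levelSubgroup (2 * n + 2) k) τ

theorem IsParabolicOver.mem_levelSubgroup {p : orthGroup (2 * n + 2) (FinAdele F)}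
    {x : (FinAdele F)ˣ} {g : orthGroup (2 * n) (FinAdele F)} (hp : IsParabolicOver p x g)
    (hpk : p ∈ levelSubgroup (2 * n + 2) k) : g ∈ levelSubgroup (2 * n) k := by
  rw [mem_levelSubgroup_iff_entry] at hpk ⊢
  intro v i j
  have h := hpk v i.castSucc.succ j.castSucc.succ
  rw [hp.middle_block] at h
  simpa only [mid_inj] using h

theorem leviElt_one_mem_levelSubgroup {g : orthGroup (2 * n) (FinAdele F)}
    (hg : g ∈ levelSubgroup (2 * n) k) : leviElt 1 g ∈ levelSubgroup (2 * n + 2) k := by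
  rw [mem_levelSubgroup_iff_entry] at hg ⊢
  intro v i j
  induction i using first_mid_last_cases with
  | h0 => induction j using first_mid_last_cases with
    | h0 => simp [leviElt]
    | hm j => simp [leviElt, (mid_ne_zero j).symm]
    | hl => simp [leviElt]
  | hm i => induction j using first_mid_last_cases with
    | h0 => simp [leviElt]
    | hm j => simpa [leviElt, mid_inj] using hg v i j
    | hl => simp [leviElt]
  | hl => induction j using first_mid_last_cases with
    | h0 => simp [leviElt]
    | hm j => simp [leviElt, (mid_ne_last j).symm]
    | hl => simp [leviElt]

/-- With `leviElt_one_mem_levelSubgroup`, this makes the image of P_f ∩ K_f in the Levi quotient a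
direct product. -/
theorem IsParabolicOver.leviElt_mem_levelSubgroup {p : orthGroup (2 * n + 2) (FinAdele F)}
    {x : (FinAdele F)ˣ} {g : orthGroup (2 * n) (FinAdele F)} (hp : IsParabolicOver p x g)
    (hpk : p ∈ levelSubgroup (2 * n + 2) k) : leviElt x 1 ∈ levelSubgroup (2 * n + 2) k := by
  rw [mem_levelSubgroup_iff_entry] at hpk ⊢
  intro v i j
  induction i using first_mid_last_cases with
  | h0 => induction j using first_mid_last_cases with
    | h0 => simpa [leviElt, hp.first_block] using hpk v 0 0
    | hm j => simp [leviElt, (mid_ne_zero j).symm]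
    | hl => simp [leviElt]
  | hm i => induction j using first_mid_last_cases with
    | h0 => simp [leviElt]
    | hm j => simp [leviElt, entry_one, apply_ite (adeleProj v)]
    | hl => simp [leviElt]
  | hl => induction j using first_mid_last_cases with
    | h0 => simp [leviElt]
    | hm j => simp [leviElt, (mid_ne_last j).symm]
    | hl => simpa [leviElt, hp.last_block] using hpk v (Fin.last _) (Fin.last _)

theorem kappa_conj_mem_levelSubgroup {g : orthGroup (2 * n) (FinAdele F)}
    (hg : g ∈ levelSubgroup (2 * n) k) :
    kappa n (FinAdele F) * g * (kappa n (FinAdele F))⁻¹ ∈ levelSubgroup (2 * n) k := by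
  refine conj_mem_levelSubgroup (mem_levelSubgroup.2 fun v => mem_localCongruence_zero.2
    fun i j => ?_) hg
  change Valued.v (adeleProj v (kappaMatrix n (FinAdele F) i j)) ≤ 1
  rw [kappaMatrix_apply, apply_ite (adeleProj v), map_one, map_zero]
  split_ifs <;> simp

theorem kappa_inv : (kappa n (FinAdele F))⁻¹ = kappa n (FinAdele F) := rfl

theorem ideleAbs_eq_one (x : (FinAdele F)ˣ)
    (hx : ∀ v, Valued.v (adeleProj v (x : FinAdele F)) ≤ 1)
    (hx' : ∀ v, Valued.v (adeleProj v ((x⁻¹ : (FinAdele F)ˣ) : FinAdele F)) ≤ 1) :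
    ideleAbs x = 1 := by
  refine finprod_eq_one_of_forall_eq_one fun v => ?_
  have h1 : Valued.v (adeleProj v (x : FinAdele F)) *
      Valued.v (adeleProj v ((x⁻¹ : (FinAdele F)ˣ) : FinAdele F)) = 1 := by
    rw [← map_mul, ← map_mul, ← Units.val_mul, mul_inv_cancel, Units.val_one, map_one, map_one]
  have h2 : Valued.v (adeleProj v (x : FinAdele F)) = 1 :=
    le_antisymm (hx v) (h1 ▸ mul_le_of_le_one_right' (hx' v))
  change (Ideal.absNorm v.asIdeal : ℚ) ^
    WithZero.log (Valued.v (adeleProj v (x : FinAdele F))) = 1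
  rw [h2, WithZero.log_one, zpow_zero]

theorem IsParabolicOver.ideleAbs_eq_one {p : orthGroup (2 * n + 2) (FinAdele F)}
    {x : (FinAdele F)ˣ} {g : orthGroup (2 * n) (FinAdele F)} (hp : IsParabolicOver p x g)
    (hpk : p ∈ levelSubgroup (2 * n + 2) k) : ideleAbs x = 1 := by
  have h0 : ∀ v i j, Valued.v (adeleProj v (entry p i j)) ≤ 1 := fun v i j => by
    have h := mem_localCongruence_zero.1
      (localCongruence_le_zero (EqualDim.mem_levelSubgroup.1 hpk v)) i j
    rwa [entry_orthMap] at h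
  refine EqualDim.ideleAbs_eq_one x (fun v => ?_) fun v => ?_
  · have h := h0 v 0 0
    rwa [hp.first_block] at h
  · have h := h0 v (Fin.last _) (Fin.last _)
    rwa [hp.last_block] at h

/-- Both x and x⁻¹ are diagonal entries of an integral matrix, so x is a unit at every place and
|x|_f = 1. -/
theorem IsParabolicOver.tateTwist_apply [CharZero E] (χ : (FinAdele F)ˣ →* Eˣ) (a : ℤ)
    {p : orthGroup (2 * n + 2) (FinAdele F)}
    {x : (FinAdele F)ˣ} {g : orthGroup (2 * n) (FinAdele F)} (hp : IsParabolicOver p x g)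
    (hpk : p ∈ levelSubgroup (2 * n + 2) k) : tateTwist χ a x = χ x := by
  have h : ((Units.map (algebraMap ℚ E : ℚ →* E)).comp ideleAbs.toHomUnits) x = 1 := by
    refine Units.ext ?_
    change algebraMap ℚ E (ideleAbs x) = 1
    rw [hp.ideleAbs_eq_one hpk, map_one]
  rw [tateTwist, MonoidHom.mul_apply, MonoidHom.zpow_apply, h, one_zpow, mul_one]

/-- A vector is fixed by the level subgroup of the Levi quotient under `χ × σ` if and only if it is
fixed by both factors. -/
theorem mem_leviInvariants_charTimes {χ : (FinAdele F)ˣ →* Eˣ}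
    {σ : Representation E (orthGroup (2 * n) (FinAdele F)) V} {w : V} :
    w ∈ leviInvariants (charTimes χ σ) k ↔
      (∀ p x g, IsParabolicOver p x g → p ∈ levelSubgroup (2 * n + 2) k →
        ((χ x : Eˣ) : E) • w = w) ∧ ∀ g ∈ levelSubgroup (2 * n) k, σ g w = w := by
  constructor
  · refine fun hw => ⟨fun p x g hp hpk => ?_, fun g hg => ?_⟩
    · have h := hw (_, x, 1) (isParabolicOver_leviElt x 1) (hp.leviElt_mem_levelSubgroup hpk)
      simpa [charTimes] using h
    · have h := hw (_, 1, g) (isParabolicOver_leviElt 1 g) (leviElt_one_mem_levelSubgroup hg)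
      simpa [charTimes] using h
  · rintro ⟨h1, h2⟩ ⟨p, x, g⟩ hp hpk
    change ((χ x : Eˣ) : E) • σ g w = w
    rw [h2 g (IsParabolicOver.mem_levelSubgroup hp hpk), h1 p x g hp hpk]

/-- The heart of the comparison; it holds for every exponent a, since the twist is invisible on P_f
∩ K_f. -/
theorem leviInvariants_twist [CharZero E] (χ : (FinAdele F)ˣ →* Eˣ)
    (σ : Representation E (orthGroup (2 * n) (FinAdele F)) V) (a : ℤ) :
    leviInvariants (charTimes (tateTwist χ⁻¹ a) (conjRep (kappa n _) σ)) k =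
      leviInvariants (charTimes χ σ) k := by
  ext w
  rw [mem_leviInvariants_charTimes, mem_leviInvariants_charTimes]
  refine and_congr ?_ ⟨fun h g hg => ?_, fun h g hg => ?_⟩
  · refine forall₅_congr fun p x g hp hpk => ?_
    rw [hp.tateTwist_apply _ _ hpk, MonoidHom.inv_apply]
    change (χ x)⁻¹ • w = w ↔ χ x • w = w
    rw [inv_smul_eq_iff, eq_comm]
  · have h1 := h _ (kappa_conj_mem_levelSubgroup hg)
    simpa [conjRep, mul_assoc] using h1
  -- Here κ⁻¹ = κ turns κ g κ⁻¹ into the κ⁻¹ g κ of `conjRep`.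
  · have h1 := h _ (kappa_conj_mem_levelSubgroup hg)
    simpa [conjRep, kappa_inv] using h1

theorem leviInvariants_le_fixedBy (χ : (FinAdele F)ˣ →* Eˣ)
    (σ : Representation E (orthGroup (2 * n) (FinAdele F)) V) :
    leviInvariants (charTimes χ σ) k ≤ fixedBy σ (levelSubgroup (2 * n) k) :=
  fun _ hw g => (mem_leviInvariants_charTimes.1 hw).2 g.1 g.2

theorem finite_and_finrank_fixedBy_algInd
    (τ : Representation E ((FinAdele F)ˣ × orthGroup (2 * n) (FinAdele F)) V)
    [Module.Finite E (leviInvariants τ k)] :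
    Module.Finite E (fixedBy (algInd τ) (levelSubgroup (2 * n + 2) k)) ∧
      Module.finrank E (fixedBy (algInd τ) (levelSubgroup (2 * n + 2) k)) =
        Nat.card (CorrCosets (parabolicCorr n (FinAdele F)) (levelSubgroup (2 * n + 2) k)) *
          Module.finrank E (leviInvariants τ k) := by
  obtain ⟨h1, h2⟩ := finite_and_finrank_equivariantFunctions iwasawa
    (fun a ha b hb => conj_mem_levelSubgroup (k := k) ha hb) (levelSubgroup_relIndex_ne_zero _ k) τ
  have e := fixedByAlgIndEquiv τ (isOpen_levelSubgroup (2 * n + 2) k)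
  exact ⟨Module.Finite.equiv e.symm, by rw [e.finrank_eq, h2]⟩

end LeviInvariants

end EqualDim

theorem mainTheorem9 {F : Type*} [Field F] [NumberField F] {E : Type*} [Field E] [CharZero E]
    (n : ℕ) (hn : 1 ≤ n)
    {V : Type*} [AddCommGroup V] [Module E V]
    (χ : (EqualDim.FinAdele F)ˣ →* Eˣ) (hχ : IsOpen (χ.ker : Set (EqualDim.FinAdele F)ˣ))
    (σ : Representation E (EqualDim.orthGroup (2 * n) (EqualDim.FinAdele F)) V)
    (hσ : EqualDim.IsAdmissibleRep σ)
    (k : HeightOneSpectrum (𝓞 F) →₀ ℕ) :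
    Module.Finite E (EqualDim.fixedBy (EqualDim.algInd (EqualDim.charTimes χ σ))
      (EqualDim.levelSubgroup (2 * n + 2) k)) ∧
    Module.Finite E (EqualDim.fixedBy (EqualDim.algInd (EqualDim.charTimes
        (EqualDim.tateTwist χ⁻¹ (2 * n)) (EqualDim.conjRep (EqualDim.kappa n _) σ)))
      (EqualDim.levelSubgroup (2 * n + 2) k)) ∧
    Module.finrank E (EqualDim.fixedBy (EqualDim.algInd (EqualDim.charTimes χ σ))
      (EqualDim.levelSubgroup (2 * n + 2) k)) =
    Module.finrank E (EqualDim.fixedBy (EqualDim.algInd (EqualDim.charTimes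
        (EqualDim.tateTwist χ⁻¹ (2 * n)) (EqualDim.conjRep (EqualDim.kappa n _) σ)))
      (EqualDim.levelSubgroup (2 * n + 2) k)) := by
  -- Admissibility of σ bounds the Levi invariants, and hence both induced spaces.
  have hfin : Module.Finite E (EqualDim.fixedBy σ (EqualDim.levelSubgroup (2 * n) k)) :=
    hσ.2 _ (EqualDim.isOpen_levelSubgroup (2 * n) k)
  have h1 : Module.Finite E (EqualDim.leviInvariants (EqualDim.charTimes χ σ) k) :=
    Submodule.finiteDimensional_of_le (EqualDim.leviInvariants_le_fixedBy χ σ)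
  have heq := EqualDim.leviInvariants_twist (k := k) χ σ (2 * n)
  have h2 : Module.Finite E (EqualDim.leviInvariants (EqualDim.charTimes
      (EqualDim.tateTwist χ⁻¹ (2 * n)) (EqualDim.conjRep (EqualDim.kappa n _) σ)) k) := by
    rwa [heq]
  obtain ⟨hf1, hr1⟩ := EqualDim.finite_and_finrank_fixedBy_algInd (k := k)
    (EqualDim.charTimes χ σ)
  obtain ⟨hf2, hr2⟩ := EqualDim.finite_and_finrank_fixedBy_algInd (k := k) (EqualDim.charTimes
    (EqualDim.tateTwist χ⁻¹ (2 * n)) (EqualDim.conjRep (EqualDim.kappa n _) σ))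
  exact ⟨hf1, hf2, by rw [hr1, hr2, heq]⟩
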